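/- Let $p$ be a prime and let $m,r,w\ge 0$ be integers. For an integer $s$ let $\binom{m}{s}_p$ be the $p$-nomial coefficient, i.e. the coefficient of $x^s$ in $(1+x+\dots+x^{p-1})^m$, and put $\binom{m}{>s}_p=\sum_{i>s}\binom{m}{i}_p$ and $\binom{m}{\le s}_p=\sum_{i\le s}\binom{m}{i}_p$. For $0\le t<m(p-1)$ write $t=\alpha(p-1)+\beta$ with $0\le\beta<p-1$ and set $$\Delta_p(m,t,w)=\sum_{j=0}^{p-\beta-1}\binom{m-\alpha-1}{>w-j}_p .$$ Let $RM_p(r,m)\subseteq\mathbb F_p^{\mathbb F_p^m}$ be the Reed–Muller code of evaluations on $\mathbb F_p^m$ of all polynomials in $m$ variables of total degree at most $r$. Let $S=\{v\in\mathbb F_p^m : |v|_M\le w\}$, where the Manhattan weight $|v|_M$ is the sum of the entries of $v$ read as integers in $\{0,\dots,p-1\}$. Let $\mathcal G'$ be $RM_p(r,m)$ punctured at $S$ (all codewords, with the coordinates in $S$ deleted) and $\mathcal G_0$ be $RM_p(r,m)$ shortened at $S$ (the codewords vanishing on $S$, with the coordinates in $S$ deleted). Let $Q$ be the CSS code $CSS(\mathcal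 G_0\to X,\ \mathcal G'^{\perp}\to Z)$ on the qudits (of dimension $p$) indexed by $\mathbb F_p^m\setminus S$, i.e. the joint $+1$ eigenspace of the Pauli operators $X^a$ $(a\in\mathcal G_0)$ and $Z^b$ $(b\in\mathcal G'^{\perp})$. When $RM_p(r,m)$ is a triorthogonal space, $Q$ is called the triorthogonal code obtained by puncturing $RM_p(r,m)$ at $S$. **Theorem.** Put $\tilde r=m(p-1)-r-1$. Suppose that $3r<m(p-1)$, that $w<m(p-1)-r$, and that $\Delta_p(m,\tilde r,w)>0$. Then $RM_p(r,m)$ is a triorthogonal space, that is, $\sum_i x_iy_iz_i=0$ and $\sum_i x_iy_i=0$ in $\mathbb F_p$ for all $x,y,z\in RM_p(r,m)$, and the triorthogonal code $Q$ has parameters $$\Big[\Big[\ \tbinom{m}{>w}_p,\ \tbinom{m}{\le w}_p,\ \Delta_p(m,\tilde r,w)\ \Big]\Big]_p .$$ Here $Q$ has parameters $[[n,k,d]]_p$ if it is a code on $n$ qudits with $\dim_{\mathbb C}Q=p^k$ and $d$ is the least weight of a Pauli operator $E$ that $Q$ does not detect, where $Q$ detects $E$ if there is a scalar $c$ with $\langle\varphi,E\psi\rangle=c\langle\varphi,\psi\rangle$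 for all $\varphi,\psi\in Q$. -/

import Mathlib

open scoped Matrix

noncomputable section

namespace QuantumReedMuller

/-! ### Classical linear codes over `ZMod p` with coordinates indexed by a finite type -/

/-- The Reed–Muller code `RM_p(r, m)`: evaluation vectors, on all points of `(ZMod p)^m`, of the
polynomials in `m` variables of total degree at most `r`. -/
def reedMuller (p r m : ℕ) : Submodule (ZMod p) ((Fin m → ZMod p) → ZMod p) where
  carrier := {c | ∃ f : MvPolynomial (Fin m) (ZMod p),
    f.totalDegree ≤ r ∧ ∀ v, c v = MvPolynomial.eval v f}
  zero_mem' := ⟨0, by simp, by simp⟩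
  add_mem' := by
    rintro c d ⟨f, hf, hcf⟩ ⟨g, hg, hdg⟩
    exact ⟨f + g, (MvPolynomial.totalDegree_add f g).trans (max_le hf hg),
      fun v => by simp [hcf, hdg]⟩
  smul_mem' := by
    rintro a c ⟨f, hf, hcf⟩
    exact ⟨a • f, (MvPolynomial.totalDegree_smul_le a f).trans hf,
      fun v => by simp [hcf, MvPolynomial.smul_eval]⟩

/-- Classical triorthogonal spaces. -/
def IsTriorthogonalSpace {p : ℕ} {ι : Type*} [Fintype ι]
    (C : Submodule (ZMod p) (ι → ZMod p)) : Prop :=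
  (∀ x ∈ C, ∀ y ∈ C, ∀ z ∈ C, ∑ i, x i * y i * z i = 0) ∧
    (∀ x ∈ C, ∀ y ∈ C, ∑ i, x i * y i = 0)

/-- The dual of a linear code with respect to the standard dot product. -/
def dualCode {p : ℕ} {ι : Type*} [Fintype ι]
    (C : Submodule (ZMod p) (ι → ZMod p)) : Submodule (ZMod p) (ι → ZMod p) where
  carrier := {y | ∀ x ∈ C, x ⬝ᵥ y = 0}
  zero_mem' := by simp
  add_mem' := by
    intro y z hy hz x hx
    rw [dotProduct_add, hy x hx, hz x hx, add_zero]
  smul_mem' := by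
    intro a y hy x hx
    rw [dotProduct_smul, hy x hx, smul_zero]

/-- The code `C` punctured at `S`: the coordinates in `S` of every codeword are deleted. -/
def punctured {p : ℕ} {ι : Type*} (C : Submodule (ZMod p) (ι → ZMod p)) (S : Finset ι) :
    Submodule (ZMod p) ({i // i ∉ S} → ZMod p) where
  carrier := {c | ∃ x ∈ C, ∀ i, c i = x i.1}
  zero_mem' := ⟨0, C.zero_mem, fun _ => rfl⟩
  add_mem' := by
    rintro c d ⟨x, hx, hcx⟩ ⟨y, hy, hdy⟩
    exact ⟨x + y, C.add_mem hx hy, fun i => by simp [hcx, hdy]⟩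
  smul_mem' := by
    rintro a c ⟨x, hx, hcx⟩
    exact ⟨a • x, C.smul_mem a hx, fun i => by simp [hcx]⟩

/-- The code `C` shortened at `S`: the coordinates in `S` are deleted from those codewords which
vanish on `S`. -/
def shortened {p : ℕ} {ι : Type*} (C : Submodule (ZMod p) (ι → ZMod p)) (S : Finset ι) :
    Submodule (ZMod p) ({i // i ∉ S} → ZMod p) where
  carrier := {c | ∃ x ∈ C, (∀ i ∈ S, x i = 0) ∧ ∀ i, c i = x i.1}
  zero_mem' := ⟨0, C.zero_mem, fun _ _ => rfl, fun _ => rfl⟩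
  add_mem' := by
    rintro c d ⟨x, hx, hx0, hcx⟩ ⟨y, hy, hy0, hdy⟩
    exact ⟨x + y, C.add_mem hx hy, fun i hi => by simp [hx0 i hi, hy0 i hi],
      fun i => by simp [hcx, hdy]⟩
  smul_mem' := by
    rintro a c ⟨x, hx, hx0, hcx⟩
    exact ⟨a • x, C.smul_mem a hx, fun i hi => by simp [hx0 i hi], fun i => by simp [hcx]⟩

/-! ### Quantum codes of qudits of dimension `p`

The state space of qudits indexed by `ι` is `(ι → ZMod p) → ℂ`: a vector `ψ` stands for
`∑ x, ψ x |x⟩`, where `x` runs over the computational basis labels. -/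

/-- The Pauli operator `X^a Z^b`, where `X^a |x⟩ = |x + a⟩` and `Z^b |x⟩ = ω^(b ⬝ x) |x⟩` with
`ω = exp (2 π i / p)`. -/
def pauli {p : ℕ} [NeZero p] {ι : Type*} [Fintype ι] (a b : ι → ZMod p) :
    ((ι → ZMod p) → ℂ) →ₗ[ℂ] ((ι → ZMod p) → ℂ) where
  toFun ψ := fun x => ZMod.stdAddChar (b ⬝ᵥ (x - a)) * ψ (x - a)
  map_add' ψ φ := by
    funext x
    simp [mul_add]
  map_smul' c ψ := by
    funext x
    simp [mul_left_comm]

/-- The weight of `X^a Z^b`: the number of qudits on which it is not a scalar. -/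
def pauliWeight {p : ℕ} {ι : Type*} [Fintype ι] (a b : ι → ZMod p) : ℕ :=
  (Finset.univ.filter fun i => a i ≠ 0 ∨ b i ≠ 0).card

/-- `CSS(C_X → X, C_Z → Z)`: the joint `+1` eigenspace of the stabilizers `X^a` with `a ∈ C_X` and
`Z^b` with `b ∈ C_Z`. -/
def cssCode {p : ℕ} [NeZero p] {ι : Type*} [Fintype ι]
    (CX CZ : Submodule (ZMod p) (ι → ZMod p)) : Submodule ℂ ((ι → ZMod p) → ℂ) where
  carrier := {ψ | (∀ a ∈ CX, pauli a 0 ψ = ψ) ∧ (∀ b ∈ CZ, pauli 0 b ψ = ψ)}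
  zero_mem' := ⟨fun _ _ => map_zero _, fun _ _ => map_zero _⟩
  add_mem' := by
    rintro ψ φ ⟨h1, h2⟩ ⟨h3, h4⟩
    exact ⟨fun a ha => by rw [map_add, h1 a ha, h3 a ha],
      fun b hb => by rw [map_add, h2 b hb, h4 b hb]⟩
  smul_mem' := by
    rintro c ψ ⟨h1, h2⟩
    exact ⟨fun a ha => by rw [map_smul, h1 a ha], fun b hb => by rw [map_smul, h2 b hb]⟩

/-- The code space `Q` detects the error `E` (Knill–Laflamme): there is a scalar `c` with
`⟨φ, E ψ⟩ = c ⟨φ, ψ⟩` for all `φ, ψ` in `Q`. -/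
def Detects {p : ℕ} [NeZero p] {ι : Type*} [Fintype ι] [DecidableEq ι]
    (Q : Submodule ℂ ((ι → ZMod p) → ℂ))
    (E : ((ι → ZMod p) → ℂ) →ₗ[ℂ] ((ι → ZMod p) → ℂ)) : Prop :=
  ∃ c : ℂ, ∀ φ ∈ Q, ∀ ψ ∈ Q, star φ ⬝ᵥ E ψ = c * (star φ ⬝ᵥ ψ)

/-- `Q` is an `[[n, k, d]]_p` code: it lives on `n` qudits, it encodes `k` qudits (its dimension
is `p ^ k`), and `d` is the least weight of a Pauli error that it does not detect. -/
def HasParameters {p : ℕ} [NeZero p] {ι : Type*} [Fintype ι] [DecidableEq ι]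
    (Q : Submodule ℂ ((ι → ZMod p) → ℂ)) (n k d : ℕ) : Prop :=
  Fintype.card ι = n ∧ Module.finrank ℂ Q = p ^ k ∧
    IsLeast {t | ∃ a b : ι → ZMod p, ¬ Detects Q (pauli a b) ∧ pauliWeight a b = t} d

/-- The quantum code `CSS(G₀ → X, G'^⊥ → Z)` obtained from a classical space `C` and a set `S` of
puncture locations, where `G₀` and `G'` are `C` shortened and punctured at `S`. It is
the triorthogonal code of `C` and `S` when `C` is a triorthogonal space. -/
def triorthogonalCode {p : ℕ} [NeZero p] {ι : Type*} [Fintype ι] [DecidableEq ι]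
    (C : Submodule (ZMod p) (ι → ZMod p)) (S : Finset ι) :
    Submodule ℂ (({i // i ∉ S} → ZMod p) → ℂ) :=
  cssCode (shortened C S) (dualCode (punctured C S))

/-! ### Manhattan weight and `p`-nomial coefficients -/

/-- The Manhattan weight of a vector, its entries being read in `{0, …, p - 1}`. -/
def manhattanWeight {p m : ℕ} (v : Fin m → ZMod p) : ℕ := ∑ i, (v i).val

/-- The points of `(ZMod p)^m` of Manhattan weight at most `w`. -/
def manhattanBall (p m w : ℕ) [NeZero p] : Finset (Fin m → ZMod p) :=
  Finset.univ.filter fun v => manhattanWeight v ≤ w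

/-- The `p`-nomial coefficient: the coefficient of `x ^ s` in `(1 + x + ⋯ + x ^ (p - 1)) ^ m`. -/
def pnomial (p m s : ℕ) : ℕ :=
  ((∑ j ∈ Finset.range p, (Polynomial.X : Polynomial ℕ) ^ j) ^ m).coeff s

/-- The sum of the `p`-nomial coefficients with lower index `≤ s`. -/
def pnomialLE (p m s : ℕ) : ℕ := ∑ i ∈ Finset.range (s + 1), pnomial p m i

/-- The sum of the `p`-nomial coefficients with lower index `> s`, for an integer `s` which may be
negative (the coefficients of index larger than `m (p - 1)` vanish). -/
def pnomialGT (p m : ℕ) (s : ℤ) : ℕ :=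
  ∑ i ∈ (Finset.range (m * (p - 1) + 1)).filter (fun i : ℕ => s < (i : ℤ)), pnomial p m i

/-- `Δ_p(m, r, w)` for `r ≤ m (p - 1)`: with `r = α (p - 1) + β` and `0 ≤ β < p - 1`, it is the sum
over `0 ≤ j ≤ p - β - 1` of the sum of the `p`-nomial coefficients with upper index `m - α - 1`
and lower index `> w - j`. In the extreme case `r = m (p - 1)`, that is `α = m` and `β = 0`, it is
the sum of the `p`-nomial coefficients with upper index `0` and lower index `> w`. -/
def Delta (p m r w : ℕ) : ℕ :=
  if r / (p - 1) < m then
    ∑ j ∈ Finset.range (p - r % (p - 1)), pnomialGT p (m - r / (p - 1) - 1) ((w : ℤ) - (j : ℤ))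
  else pnomialGT p 0 (w : ℤ)

end QuantumReedMuller

end

open scoped Matrix

noncomputable section

namespace QuantumReedMuller

/-! ### Duality between puncturing and shortening -/

section Codes

/-! Write `C` for the Reed–Muller code. A sum over all points of a polynomial of degree below `m *
(p - 1)` is zero; this gives triorthogonality, and the dual of `C` is the Reed–Muller code of degree
`t = m * (p - 1) - r - 1`, which contains `C`.

A general fact on CSS codes (`hasParameters_triorthogonalCode`) then reduces the parameters to one
classical question: the least number `d` of nonzero coordinates outside `S` of a nonzero dual word.
If `d > 0`, no nonzero dual word is supported in `S`, so `C` restricts onto all of `S` and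
injectively to the complement, and the dimension is `p ^ |S|`. Undetected errors lift to dual words,
so they have weight at least `d`; a minimal dual word that is nonzero somewhere on `S` gives an
undetected `Z`-error.

The minimum is found by a footprint bound (`card_le_card_eval_ne_zero`): a polynomial with leading
exponent `u` has at least as many nonzeros of weight `> w` as the box with sides `p - 1 - u i` has
points of weight `> w`. This number is a tail of the coefficients of a product of polynomials `1 + x
+ ⋯ + x ^ L`. For a given total side length the coefficientwise least product has as many full sides
as possible (`coeffLE_packedBox_sum`), and its tail is `Delta`. A product of linear factors attains
the bound. -/

theorem shortened_le_punctured {p : ℕ} {ι : Type*} {C : Submodule (ZMod p) (ι → ZMod p)}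
    {S : Finset ι} : shortened C S ≤ punctured C S := by
  rintro c ⟨x, hx, -, hcx⟩
  exact ⟨x, hx, hcx⟩

variable {p : ℕ} [Fact p.Prime] {ι : Type*} [Fintype ι]

theorem mem_dualCode {C : Submodule (ZMod p) (ι → ZMod p)} {y : ι → ZMod p} :
    y ∈ dualCode C ↔ ∀ x ∈ C, x ⬝ᵥ y = 0 := Iff.rfl

theorem dualCode_dualCode (C : Submodule (ZMod p) (ι → ZMod p)) :
    dualCode (dualCode C) = C := by
  classical
  let B : LinearMap.BilinForm (ZMod p) (ι → ZMod p) := dotProductBilin (ZMod p) (ZMod p)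
  have hB₀ : B.IsRefl := fun x y h => by
    change y ⬝ᵥ x = 0
    rw [dotProduct_comm]
    exact h
  have hB : B.Nondegenerate := by
    refine (LinearMap.IsRefl.nondegenerate_iff_separatingLeft hB₀).2 fun x hx => ?_
    exact dotProduct_eq_zero x hx
  have h (N : Submodule (ZMod p) (ι → ZMod p)) : dualCode N = B.orthogonal N := rfl
  rw [h, h]
  exact LinearMap.BilinForm.orthogonal_orthogonal hB hB₀ C

theorem mem_of_forall_dualCode {C : Submodule (ZMod p) (ι → ZMod p)} {y : ι → ZMod p}
    (h : ∀ x ∈ dualCode C, x ⬝ᵥ y = 0) : y ∈ C := by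
  rw [← dualCode_dualCode C]
  exact h

variable [DecidableEq ι] {C : Submodule (ZMod p) (ι → ZMod p)} {S : Finset ι}

theorem dotProduct_eq_add (S : Finset ι) (x y : ι → ZMod p) :
    x ⬝ᵥ y = (∑ i ∈ S, x i * y i) +
      (fun i : {i // i ∉ S} => x i) ⬝ᵥ (fun i : {i // i ∉ S} => y i) := by
  have h : (fun i : {i // i ∉ S} => x i) ⬝ᵥ (fun i : {i // i ∉ S} => y i) =
      ∑ i ∈ Sᶜ, x i * y i :=
    (Finset.sum_subtype Sᶜ (by simp) fun i => x i * y i).symm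
  rw [h, Finset.sum_add_sum_compl]
  rfl

/-- Extension by zero on `S` identifies the functionals killing the punctured code with the dual
words vanishing on `S`. -/
theorem dualCode_punctured : dualCode (punctured C S) = shortened (dualCode C) S := by
  ext b
  constructor
  · intro hb
    let y : ι → ZMod p := fun i => if h : i ∉ S then b ⟨i, h⟩ else 0
    have hy (i : {i // i ∉ S}) : b i = y i := by simp [y, i.2]
    refine ⟨y, fun x hx => ?_, fun i hi => by simp [y, hi], hy⟩
    rw [dotProduct_eq_add S, Finset.sum_eq_zero fun i hi => by simp [y, hi], zero_add,
      ← hb _ ⟨x, hx, fun _ => rfl⟩]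
    exact congrArg _ (funext fun i => (hy i).symm)
  · rintro ⟨y, hy, hyS, hby⟩ c ⟨x, hx, hcx⟩
    have h := hy x hx
    rw [dotProduct_eq_add S, Finset.sum_eq_zero fun i hi => by simp [hyS i hi], zero_add] at h
    rw [funext hby, funext hcx]
    exact h

theorem dualCode_shortened : dualCode (shortened C S) = punctured (dualCode C) S := by
  rw [← dualCode_dualCode (punctured (dualCode C) S), dualCode_punctured, dualCode_dualCode]

/-- If restriction to `S` were not onto, a nonzero functional would kill its image; extended by zero
it would be a nonzero dual word supported in `S`. -/
theorem exists_mem_forall_eq_of_dualCode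
    (h : ∀ y ∈ dualCode C, (∀ i ∉ S, y i = 0) → y = 0) (g : S → ZMod p) :
    ∃ x ∈ C, ∀ i : S, x i = g i := by
  let ρ : (ι → ZMod p) →ₗ[ZMod p] (S → ZMod p) :=
    LinearMap.funLeft (ZMod p) (ZMod p) ((↑) : S → ι)
  have hg : g ∈ C.map ρ := by
    refine mem_of_forall_dualCode fun b hb => ?_
    let y : ι → ZMod p := fun i => if h : i ∈ S then b ⟨i, h⟩ else 0
    have hy : y = 0 := by
      refine h y (fun x hx => ?_) fun i hi => by simp [y, hi]
      have h0 := hb (ρ x) (Submodule.mem_map_of_mem hx)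
      rw [← h0]
      have h1 : x ⬝ᵥ y = ∑ i ∈ S, x i * y i :=
        (Finset.sum_subset (Finset.subset_univ S) fun i _ hi => by simp [y, hi]).symm
      rw [h1, ← Finset.sum_coe_sort]
      exact Finset.sum_congr rfl fun i _ => by simp [y, ρ, LinearMap.funLeft_apply]
    have hb0 : b = 0 := funext fun i => by simpa [y] using congrFun hy i
    rw [hb0, zero_dotProduct]
  obtain ⟨x, hx, hxg⟩ := hg
  exact ⟨x, hx, fun i => by rw [← hxg]; rfl⟩

end Codes

/-! ### Detection, dimension and distance of CSS codes -/

section Quantum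

open scoped ComplexOrder

variable {p : ℕ} [Fact p.Prime] {ι : Type*} [Fintype ι]

/-- The `X`-stabilizers are translations. The `Z`-stabilizers are diagonal with character values,
and faithfulness of the character turns eigenvalue `1` into orthogonality. -/
theorem mem_cssCode {CX CZ : Submodule (ZMod p) (ι → ZMod p)} {ψ : (ι → ZMod p) → ℂ} :
    ψ ∈ cssCode CX CZ ↔
      (∀ a ∈ CX, ∀ x, ψ (x + a) = ψ x) ∧ ∀ x, ψ x ≠ 0 → x ∈ dualCode CZ := by
  refine and_congr (forall₂_congr fun a _ => ?_) ⟨fun h x hx b hb => ?_, fun h b hb => ?_⟩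
  · rw [funext_iff]
    refine ⟨fun h x => ?_, fun h x => ?_⟩
    · have := h (x + a)
      simpa [pauli] using this.symm
    · have := h (x - a)
      rw [sub_add_cancel] at this
      simp [pauli, this]
  · have h1 := congrFun (h b hb) x
    have h2 : ZMod.stdAddChar (b ⬝ᵥ x) * ψ x = ψ x := by simpa [pauli] using h1
    have h3 := mul_right_cancel₀ hx (h2.trans (one_mul _).symm)
    rw [← AddChar.map_zero_eq_one (ZMod.stdAddChar (N := p))] at h3
    exact ZMod.injective_stdAddChar h3
  · funext x
    have h2 : ZMod.stdAddChar (b ⬝ᵥ x) * ψ x = ψ x := by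
      by_cases hx : ψ x = 0
      · simp [hx]
      · rw [h x hx b hb, AddChar.map_zero_eq_one, one_mul]
    simpa [pauli] using h2

variable [DecidableEq ι]

theorem star_dotProduct_pauli (a b : ι → ZMod p) (φ ψ : (ι → ZMod p) → ℂ) :
    star φ ⬝ᵥ pauli a b ψ =
      ∑ x, star (φ (x + a)) * (ZMod.stdAddChar (b ⬝ᵥ x) * ψ x) := by
  refine Fintype.sum_equiv (Equiv.subRight a) _ _ fun x => ?_
  simp [pauli]

theorem detects_pauli_of_notMem_dualCode_right
    {CX CZ : Submodule (ZMod p) (ι → ZMod p)} {a b : ι → ZMod p} (ha : a ∉ dualCode CZ) :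
    Detects (cssCode CX CZ) (pauli a b) := by
  refine ⟨0, fun φ hφ ψ hψ => ?_⟩
  rw [star_dotProduct_pauli, zero_mul]
  refine Finset.sum_eq_zero fun x _ => ?_
  by_contra h
  have h1 : ψ x ≠ 0 := fun h0 => h (by simp [h0])
  have h2 : φ (x + a) ≠ 0 := fun h0 => h (by simp [h0])
  have h3 := (dualCode CZ).sub_mem ((mem_cssCode.1 hφ).2 _ h2) ((mem_cssCode.1 hψ).2 _ h1)
  -- Two support points differing by `a` would put `a` in the dual of `CZ`.
  rw [add_sub_cancel_left] at h3
  exact ha h3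

theorem detects_pauli_of_notMem_dualCode_left
    {CX CZ : Submodule (ZMod p) (ι → ZMod p)} {a b : ι → ZMod p} (hb : b ∉ dualCode CX) :
    Detects (cssCode CX CZ) (pauli a b) := by
  refine ⟨0, fun φ hφ ψ hψ => ?_⟩
  rw [zero_mul]
  rw [mem_dualCode] at hb
  push Not at hb
  obtain ⟨c, hc, hcb⟩ := hb
  -- Translating the summation variable by `c` multiplies the matrix element by a root of unity,
  -- nontrivial since `c ⬝ᵥ b ≠ 0`; hence it vanishes.
  have h : star φ ⬝ᵥ pauli a b ψ =
      ZMod.stdAddChar (c ⬝ᵥ b) * (star φ ⬝ᵥ pauli a b ψ) := by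
    rw [star_dotProduct_pauli, Finset.mul_sum]
    refine Fintype.sum_equiv (Equiv.subRight c) _ _ fun x => ?_
    have h1 : φ (x - c + a) = φ (x + a) := by
      rw [← (mem_cssCode.1 hφ).1 c hc (x - c + a)]
      congr 1
      abel
    have h2 : ψ (x - c) = ψ x := by
      rw [← (mem_cssCode.1 hψ).1 c hc (x - c), sub_add_cancel]
    have h3 : ZMod.stdAddChar (b ⬝ᵥ x) =
        ZMod.stdAddChar (c ⬝ᵥ b) * ZMod.stdAddChar (b ⬝ᵥ (x - c)) := by
      rw [← AddChar.map_add_eq_mul, dotProduct_sub, dotProduct_comm c b, add_sub_cancel]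
    simp only [Equiv.subRight_apply, h1, h2, h3]
    ring
  by_contra h0
  have h1 := mul_right_cancel₀ h0 ((one_mul _).trans h)
  rw [← AddChar.map_zero_eq_one (ZMod.stdAddChar (N := p))] at h1
  exact hcb (ZMod.injective_stdAddChar h1).symm

theorem detects_pauli_zero_zero (Q : Submodule ℂ ((ι → ZMod p) → ℂ)) :
    Detects Q (pauli 0 0) := by
  refine ⟨1, fun φ _ ψ _ => ?_⟩
  have h : pauli (p := p) (ι := ι) 0 0 ψ = ψ := funext fun x => by simp [pauli]
  rw [h, one_mul]

/-- A `Z`-type error detected by a CSS code which commutes with its stabilizers acts trivially. -/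
theorem mem_dualCode_of_detects {CX CZ : Submodule (ZMod p) (ι → ZMod p)}
    (hX : CX ≤ dualCode CZ) {b : ι → ZMod p} (hb : b ∈ dualCode CX)
    (h : Detects (cssCode CX CZ) (pauli 0 b)) : b ∈ dualCode (dualCode CZ) := by
  classical
  obtain ⟨c, hc⟩ := h
  -- The unnormalized coset state of `y + CX`. It is an eigenvector of `Z^b` with eigenvalue given
  -- by `b ⬝ᵥ y`; detection forces this to be independent of `y`, and `y = 0` fixes its value.
  let ψ (y : ι → ZMod p) : (ι → ZMod p) → ℂ := fun x => if x - y ∈ CX then 1 else 0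
  have hψ (y) (hy : y ∈ dualCode CZ) : ψ y ∈ cssCode CX CZ := by
    refine mem_cssCode.2 ⟨fun a ha x => ?_, fun x hx => ?_⟩
    · simp only [ψ]
      rw [add_sub_right_comm, CX.add_mem_iff_left ha]
    · have h1 : x - y ∈ CX := by
        by_contra h
        exact hx (by simp [ψ, h])
      simpa using (dualCode CZ).add_mem (hX h1) hy
  have key (y) (hy : y ∈ dualCode CZ) : ZMod.stdAddChar (b ⬝ᵥ y) = c := by
    have h1 := hc _ (hψ y hy) _ (hψ y hy)
    have h2 : star (ψ y) ⬝ᵥ pauli 0 b (ψ y) =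
        ZMod.stdAddChar (b ⬝ᵥ y) * (star (ψ y) ⬝ᵥ ψ y) := by
      rw [star_dotProduct_pauli, dotProduct.eq_def (star (ψ y)), Finset.mul_sum]
      refine Finset.sum_congr rfl fun x _ => ?_
      by_cases hx : x - y ∈ CX
      · have h3 := hb _ hx
        rw [dotProduct_comm, dotProduct_sub, sub_eq_zero] at h3
        simp [ψ, hx, h3]
      · simp [ψ, hx]
    rw [h2] at h1
    refine mul_right_cancel₀ (fun h0 => ?_) h1
    rw [dotProduct_star_self_eq_zero] at h0
    have := congrFun h0 y
    simp [ψ] at this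
  have h0 := key 0 (zero_mem _)
  rw [dotProduct_zero] at h0
  intro y hy
  rw [dotProduct_comm]
  exact ZMod.injective_stdAddChar ((key y hy).trans h0.symm)

variable {C : Submodule (ZMod p) (ι → ZMod p)} {S : Finset ι}

theorem mem_triorthogonalCode {ψ : ({i // i ∉ S} → ZMod p) → ℂ} :
    ψ ∈ triorthogonalCode C S ↔
      (∀ a ∈ shortened C S, ∀ x, ψ (x + a) = ψ x) ∧ ∀ x, ψ x ≠ 0 → x ∈ punctured C S := by
  rw [triorthogonalCode, mem_cssCode, dualCode_dualCode]

/-- A code state is a function on the quotient of the punctured by the shortened code. By `hC` the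
punctured code is a copy of `C`, and by `hS` the quotient is the space of all values on `S`. -/
theorem finrank_triorthogonalCode
    (hC : ∀ x ∈ C, (∀ i ∉ S, x i = 0) → x = 0)
    (hS : ∀ g : S → ZMod p, ∃ x ∈ C, ∀ i : S, x i = g i) :
    Module.finrank ℂ (triorthogonalCode C S) = p ^ S.card := by
  classical
  choose σ hσ hσS using hS
  have huniq (x y : ι → ZMod p) (hx : x ∈ C) (hy : y ∈ C) (h : ∀ i : {i // i ∉ S}, x i = y i) :
      x = y :=
    sub_eq_zero.1 (hC _ (C.sub_mem hx hy) fun i hi => sub_eq_zero.2 (h ⟨i, hi⟩))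
  let Φ : triorthogonalCode C S →ₗ[ℂ] ((S → ZMod p) → ℂ) :=
    { toFun := fun ψ g => ψ.1 fun i => σ g i
      map_add' := fun _ _ => rfl
      map_smul' := fun _ _ => rfl }
  have hΦ : Function.Bijective Φ := by
    refine ⟨(injective_iff_map_eq_zero Φ).2 fun ψ hψ => ?_, fun h => ?_⟩
    · obtain ⟨h1, h2⟩ := mem_triorthogonalCode.1 ψ.2
      ext x
      by_contra hx
      obtain ⟨y, hy, hxy⟩ := h2 x hx
      let g : S → ZMod p := fun i => y i
      have ha : (fun i : {i // i ∉ S} => (y - σ g) i) ∈ shortened C S :=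
        ⟨y - σ g, C.sub_mem hy (hσ g), fun i hi => sub_eq_zero.2 (hσS g ⟨i, hi⟩).symm,
          fun _ => rfl⟩
      have h3 := h1 _ ha fun i => σ g i
      apply hx
      have h4 : x = (fun i : {i // i ∉ S} => σ g i) + fun i : {i // i ∉ S} => (y - σ g) i :=
        funext fun i => by simp [hxy]
      rw [h4, h3]
      exact congrFun hψ g
    · let ψ : ({i // i ∉ S} → ZMod p) → ℂ := fun x =>
        if hx : x ∈ punctured C S then h fun i => hx.choose i else 0
      have hψ (y) (hy : y ∈ C) : ψ (fun i => y i) = h fun i => y i := by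
        have hx : (fun i : {i // i ∉ S} => y i) ∈ punctured C S := ⟨y, hy, fun _ => rfl⟩
        have h1 : hx.choose = y :=
          huniq _ _ hx.choose_spec.1 hy fun i => (hx.choose_spec.2 i).symm
        simp only [ψ, dif_pos hx, h1]
      refine ⟨⟨ψ, mem_triorthogonalCode.2 ⟨fun a ha x => ?_, fun x hx => ?_⟩⟩, ?_⟩
      · by_cases hx : x ∈ punctured C S
        · obtain ⟨y, hy, hxy⟩ := hx
          obtain ⟨z, hz, hzS, haz⟩ := ha
          rw [funext hxy, funext haz]
          have h1 := hψ (y + z) (C.add_mem hy hz)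
          have h2 : (fun i : {i // i ∉ S} => (y + z) i) =
              (fun i : {i // i ∉ S} => y i) + fun i : {i // i ∉ S} => z i := rfl
          rw [h2] at h1
          rw [h1, hψ y hy]
          exact congrArg h (funext fun i => by simp [hzS i i.2])
        · have hxa : x + a ∉ punctured C S := by
            rwa [(punctured C S).add_mem_iff_left (shortened_le_punctured ha)]
          simp only [ψ, dif_neg hx, dif_neg hxa]
      · by_contra h0
        exact hx (by simp only [ψ, dif_neg h0])
      · funext g
        exact (hψ _ (hσ g)).trans (congrArg h (funext (hσS g)))
  rw [(LinearEquiv.ofBijective Φ hΦ).finrank_eq, Module.finrank_fintype_fun_eq_card]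
  simp [ZMod.card]

theorem hasParameters_triorthogonalCode (hC : C ≤ dualCode C) {d : ℕ} (hd : 0 < d)
    (hmin : ∀ y ∈ dualCode C, y ≠ 0 →
      d ≤ (Finset.univ.filter fun i : {i // i ∉ S} => y i ≠ 0).card)
    {y : ι → ZMod p} (hy : y ∈ dualCode C) (hyS : ∃ i ∈ S, y i ≠ 0)
    (hyd : (Finset.univ.filter fun i : {i // i ∉ S} => y i ≠ 0).card = d) :
    HasParameters (triorthogonalCode C S) (Fintype.card {i // i ∉ S}) S.card d := by
  have hzero (y) (hy : y ∈ dualCode C) (h : ∀ i ∉ S, y i = 0) : y = 0 := by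
    by_contra h0
    have h1 := hmin y hy h0
    rw [Finset.filter_false_of_mem fun (i : {i // i ∉ S}) _ => not_not.2 (h i i.2)] at h1
    simp at h1
    lia
  refine ⟨rfl, ?_, ⟨0, fun i : {i // i ∉ S} => y i, fun h => ?_, ?_⟩, ?_⟩
  · exact finrank_triorthogonalCode (fun x hx => hzero x (hC hx))
      (exists_mem_forall_eq_of_dualCode hzero)
  · have h1 := mem_dualCode_of_detects
      (by rw [dualCode_dualCode]; exact shortened_le_punctured)
      (by rw [dualCode_shortened]; exact ⟨y, hy, fun _ => rfl⟩) h
    rw [dualCode_dualCode, dualCode_punctured] at h1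
    obtain ⟨z, hz, hzS, hyz⟩ := h1
    obtain ⟨i, hi, hyi⟩ := hyS
    -- If the error were detected, `y` would agree off `S` with a dual word `z` vanishing on `S`.
    -- Then `y - z` is supported in `S`, so it is zero, against `y` being nonzero on `S`.
    have h2 : y - z = 0 :=
      hzero _ (Submodule.sub_mem _ hy hz) fun i hi => sub_eq_zero.2 (hyz ⟨i, hi⟩)
    exact hyi (by rw [sub_eq_zero.1 h2, hzS i hi])
  · simp [pauliWeight, ← hyd]
  · rintro _ ⟨a, b, hab, rfl⟩
    have ha : a ∈ punctured (dualCode C) S := by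
      by_contra h
      refine hab (detects_pauli_of_notMem_dualCode_right fun h1 => h ?_)
      rw [dualCode_dualCode] at h1
      obtain ⟨x, hx, hax⟩ := h1
      -- Self-orthogonality places the `X`-part too in the punctured dual, so one bound serves both
      -- parts.
      exact ⟨x, hC hx, hax⟩
    have hb : b ∈ punctured (dualCode C) S := by
      by_contra h
      rw [← dualCode_shortened] at h
      exact hab (detects_pauli_of_notMem_dualCode_left h)
    obtain ⟨x, hx, hax⟩ := ha
    obtain ⟨z, hz, hbz⟩ := hb
    by_cases hx0 : x = 0
    · by_cases hz0 : z = 0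
      · refine absurd ?_ hab
        have ha0 : a = 0 := funext fun i => by simp [hax, hx0]
        have hb0 : b = 0 := funext fun i => by simp [hbz, hz0]
        rw [ha0, hb0]
        exact detects_pauli_zero_zero _
      · refine (hmin z hz hz0).trans (Finset.card_le_card fun i hi => ?_)
        simp only [Finset.mem_filter, Finset.mem_univ, true_and] at hi ⊢
        exact Or.inr (by rwa [hbz])
    · refine (hmin x hx hx0).trans (Finset.card_le_card fun i hi => ?_)
      simp only [Finset.mem_filter, Finset.mem_univ, true_and] at hi ⊢
      exact Or.inl (by rwa [hax])

end Quantum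

/-! ### Reed–Muller codes: footprint bound, triorthogonality, duality -/

section ReedMuller

open MvPolynomial MonomialOrder

theorem reedMuller_mono {p m r s : ℕ} (h : r ≤ s) : reedMuller p r m ≤ reedMuller p s m := by
  rintro c ⟨f, hf, hcf⟩
  exact ⟨f, hf.trans h, hcf⟩

variable {p : ℕ} [Fact p.Prime] {m : ℕ}

theorem sum_zmod_val {M : Type*} [AddCommMonoid M] (F : ℕ → M) :
    ∑ x : ZMod p, F x.val = ∑ j ∈ Finset.range p, F j :=
  Finset.sum_nbij' ZMod.val (fun j => (j : ZMod p))
    (fun x _ => Finset.mem_range.2 x.val_lt) (fun _ _ => Finset.mem_univ _)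
    (fun x _ => ZMod.natCast_zmod_val x)
    (fun _ hj => ZMod.val_cast_of_lt (Finset.mem_range.1 hj)) (fun _ _ => rfl)

theorem exists_pow_eq_pow_le_pred (e : ℕ) :
    ∃ d ≤ e, d ≤ p - 1 ∧ ∀ x : ZMod p, x ^ d = x ^ e := by
  have hp : 0 < p - 1 := by have := (Fact.out : p.Prime).two_le; lia
  obtain rfl | he := Nat.eq_zero_or_pos e
  · exact ⟨0, le_rfl, Nat.zero_le _, fun _ => rfl⟩
  have h1 := Nat.mod_lt (e - 1) hp
  have h2 := Nat.mod_add_div (e - 1) (p - 1)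
  -- Reducing `e - 1` and adding `1` keeps a positive exponent positive, so that the powers also
  -- agree at `0`.
  refine ⟨(e - 1) % (p - 1) + 1, ?_, h1, fun x => ?_⟩
  · have := Nat.mod_le (e - 1) (p - 1)
    lia
  · obtain rfl | hx := eq_or_ne x 0
    · rw [zero_pow (Nat.succ_ne_zero _), zero_pow he.ne']
    · have h3 : e = (e - 1) % (p - 1) + 1 + (p - 1) * ((e - 1) / (p - 1)) := by lia
      conv_rhs => rw [h3, pow_add, pow_mul, ZMod.pow_card_sub_one_eq_one hx, one_pow, mul_one]

theorem exists_reduced_of_mem_reedMuller {r : ℕ} {c : (Fin m → ZMod p) → ZMod p}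
    (hc : c ∈ reedMuller p r m) :
    ∃ f : MvPolynomial (Fin m) (ZMod p), f.totalDegree ≤ r ∧
      (∀ s ∈ f.support, ∀ i, s i ≤ p - 1) ∧ ∀ v, c v = eval v f := by
  obtain ⟨f, hf, hcf⟩ := hc
  choose ρ hρ hρp hρx using exists_pow_eq_pow_le_pred (p := p)
  let red (s : Fin m →₀ ℕ) : Fin m →₀ ℕ := Finsupp.equivFunOnFinite.symm fun i => ρ (s i)
  refine ⟨∑ s ∈ f.support, monomial (red s) (f.coeff s), ?_, fun s hs i => ?_, fun v => ?_⟩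
  · refine totalDegree_finsetSum_le fun s hs => (totalDegree_monomial_le _ _).trans ?_
    refine le_trans ?_ ((le_totalDegree hs).trans hf)
    rw [Finsupp.sum_fintype _ _ fun _ => rfl, Finsupp.sum_fintype _ _ fun _ => rfl]
    exact Finset.sum_le_sum fun i _ => hρ _
  · have h1 := support_sum hs
    rw [Finset.mem_biUnion] at h1
    obtain ⟨t, -, ht⟩ := h1
    rw [Finset.mem_singleton.1 (support_monomial_subset ht)]
    exact hρp _
  · rw [hcf, map_sum, eval_eq']
    refine Finset.sum_congr rfl fun s _ => ?_
    rw [eval_monomial, Finsupp.prod_fintype _ _ fun _ => pow_zero _]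
    exact congrArg _ (Finset.prod_congr rfl fun i _ => (hρx _ _).symm)

/-- The footprint bound for the complement of a Manhattan ball. -/
theorem card_le_card_eval_ne_zero {f : MvPolynomial (Fin m) (ZMod p)} (hf : f ≠ 0) (w : ℕ) :
    (Finset.univ.filter fun y : Fin m → ZMod p =>
      (∀ i, (y i).val + degLex.degree f i ≤ p - 1) ∧ w < manhattanWeight y).card ≤
    (Finset.univ.filter fun x : Fin m → ZMod p => eval x f ≠ 0 ∧ w < manhattanWeight x).card := by
  classical
  have hp := (Fact.out : p.Prime).two_le
  set u := degLex.degree f with hu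
  set Y := Finset.univ.filter fun y : Fin m → ZMod p =>
    (∀ i, (y i).val + u i ≤ p - 1) ∧ w < manhattanWeight y
  set T := Finset.univ.filter fun x : Fin m → ZMod p => eval x f ≠ 0 ∧ w < manhattanWeight x
  -- Chosen so that `e y + u` has entries `p - 1 - y i`. Evaluation on `T` will be injective on the
  -- span of these monomials, whence the bound by comparing dimensions.
  let e (y : Y) : Fin m →₀ ℕ := Finsupp.equivFunOnFinite.symm fun i => p - 1 - (y.1 i).val - u i
  have hY (y : Y) : (∀ i, (y.1 i).val + u i ≤ p - 1) ∧ w < manhattanWeight y.1 :=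
    (Finset.mem_filter.1 y.2).2
  have heu (y : Y) (i) : e y i + u i = p - 1 - (y.1 i).val := by
    have := (hY y).1 i
    change p - 1 - (y.1 i).val - u i + u i = _
    lia
  have he : Function.Injective e := fun y z h => by
    refine Subtype.ext (funext fun i => ZMod.val_injective p ?_)
    have h1 := heu y i
    have h2 := heu z i
    have h3 := (hY y).1 i
    have h4 := (hY z).1 i
    rw [h] at h1
    lia
  let G : (Y → ZMod p) →ₗ[ZMod p] MvPolynomial (Fin m) (ZMod p) :=
    ∑ y : Y, (monomial (e y)).comp (LinearMap.proj y)
  have hG (c : Y → ZMod p) : G c = ∑ y, monomial (e y) (c y) := by simp [G, LinearMap.sum_apply]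
  let Φ : (Y → ZMod p) →ₗ[ZMod p] (T → ZMod p) :=
    (LinearMap.pi fun x : T => (aeval x.1).toLinearMap).comp G
  have hΦ : Function.Injective Φ := by
    refine (injective_iff_map_eq_zero Φ).2 fun c hc => ?_
    by_contra hc0
    have hg0 : G c ≠ 0 := by
      contrapose! hc0
      funext y
      have h1 := congrArg (coeff (e y)) hc0
      simpa [hG, coeff_sum, coeff_monomial, he.eq_iff] using h1
    obtain ⟨y, hy⟩ : ∃ y, degLex.degree (G c) = e y := by
      have h1 : degLex.degree (G c) ∈ (∑ y, monomial (e y) (c y)).support := by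
        rw [← hG]
        exact degLex.degree_mem_support hg0
      have h2 := support_sum h1
      rw [Finset.mem_biUnion] at h2
      obtain ⟨y, -, hy⟩ := h2
      exact ⟨y, Finset.mem_singleton.1 (support_monomial_subset hy)⟩
    have hdeg : degLex.degree (G c * f) = e y + u := by rw [degree_mul hg0 hf, hy]
    -- The leading exponent of `G c * f` has full total degree, because the order is `degLex`. The
    -- grid of points above `y` has sides of size `p - y i`, one more than this exponent, so the
    -- product is nonzero at some grid point, whose weight is at least that of `y`.
    obtain ⟨x, hxS, hx⟩ := combinatorial_nullstellensatz_exists_eval_nonzero (G c * f) (e y + u)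
      (by rw [← hdeg]; exact coeff_degree_ne_zero_iff.2 (mul_ne_zero hg0 hf))
      (by rw [← hdeg, degree_degLexDegree])
      (fun i => Finset.univ.filter fun a : ZMod p => (y.1 i).val ≤ a.val) fun i => by
        rw [Finset.card_filter, sum_zmod_val fun j => if (y.1 i).val ≤ j then 1 else 0,
          ← Finset.card_filter]
        have h1 : (Finset.range p).filter (fun j => (y.1 i).val ≤ j) =
            Finset.Ico (y.1 i).val p := by
          ext j
          simp [and_comm]
        have h2 := (y.1 i).val_lt
        rw [h1, Nat.card_Ico, Finsupp.add_apply, heu]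
        lia
    rw [map_mul] at hx
    have hxT : x ∈ T := by
      refine Finset.mem_filter.2 ⟨Finset.mem_univ _, right_ne_zero_of_mul hx, (hY y).2.trans_le ?_⟩
      exact Finset.sum_le_sum fun i _ => (Finset.mem_filter.1 (hxS i)).2
    refine left_ne_zero_of_mul hx ?_
    have h1 := congrFun hc ⟨x, hxT⟩
    simpa [Φ, coe_aeval_eq_eval] using h1
  simpa using LinearMap.finrank_le_finrank_of_injective hΦ

theorem sum_mul_eq_zero_of_mem_reedMuller {r s : ℕ} (h : r + s < m * (p - 1))
    {x y : (Fin m → ZMod p) → ZMod p} (hx : x ∈ reedMuller p r m) (hy : y ∈ reedMuller p s m) :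
    ∑ v, x v * y v = 0 := by
  obtain ⟨f, hf, hxf⟩ := hx
  obtain ⟨g, hg, hyg⟩ := hy
  simp only [hxf, hyg, ← map_mul]
  refine sum_eval_eq_zero _ ?_
  rw [ZMod.card, Fintype.card_fin, mul_comm (p - 1)]
  exact ((totalDegree_mul f g).trans (add_le_add hf hg)).trans_lt h

theorem mul_mem_reedMuller {r s : ℕ} {x y : (Fin m → ZMod p) → ZMod p}
    (hx : x ∈ reedMuller p r m) (hy : y ∈ reedMuller p s m) : x * y ∈ reedMuller p (r + s) m := by
  obtain ⟨f, hf, hxf⟩ := hx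
  obtain ⟨g, hg, hyg⟩ := hy
  exact ⟨f * g, (totalDegree_mul f g).trans (add_le_add hf hg), fun v => by simp [hxf, hyg]⟩

theorem isTriorthogonalSpace_reedMuller {r : ℕ} (h : 3 * r < m * (p - 1)) :
    IsTriorthogonalSpace (reedMuller p r m) :=
  ⟨fun _ hx _ hy _ hz =>
    sum_mul_eq_zero_of_mem_reedMuller (by lia) (mul_mem_reedMuller hx hy) hz,
    fun _ hx _ hy => sum_mul_eq_zero_of_mem_reedMuller (by lia) hx hy⟩

theorem sum_prod_pow (e : Fin m → ℕ) :
    ∑ x : Fin m → ZMod p, ∏ i, x i ^ e i = ∏ i, ∑ a : ZMod p, a ^ e i := by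
  rw [Finset.prod_univ_sum, Fintype.piFinset_univ]

theorem sum_pow_pred : ∑ a : ZMod p, a ^ (p - 1) = -1 := by
  have hp := (Fact.out : p.Prime).two_le
  have h (a : ZMod p) : a ^ (p - 1) = 1 - if a = 0 then 1 else 0 := by
    split_ifs with ha
    · rw [ha, zero_pow (by lia), sub_self]
    · rw [ZMod.pow_card_sub_one_eq_one ha, sub_zero]
  simp [h, Finset.sum_sub_distrib]

/-- Given a reduced polynomial of degree above `s` with leading exponent `u`, its pairing with the
complementary monomial, of degree at most `r`, isolates the leading coefficient up to sign. -/
theorem dualCode_reedMuller {r s : ℕ} (h : r + s + 1 = m * (p - 1)) :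
    dualCode (reedMuller p r m) = reedMuller p s m := by
  refine le_antisymm (fun c hc => ?_) fun y hy x hx =>
    sum_mul_eq_zero_of_mem_reedMuller (by lia) hx hy
  obtain ⟨f, hfr, hfc⟩ : c ∈ (restrictDegree (Fin m) (ZMod p) (Fintype.card (ZMod p) - 1)).map
      (evalₗ (ZMod p) (Fin m)) := by
    rw [map_restrict_dom_evalₗ]
    trivial
  refine ⟨f, ?_, fun v => by rw [← hfc]; rfl⟩
  by_contra! hs
  have hf0 : f ≠ 0 := by
    rintro rfl
    simp at hs
  set u := degLex.degree f with hu
  have hup (i) : u i ≤ p - 1 := by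
    have := (mem_restrictDegree (Fin m) f _).1 hfr u (degLex.degree_mem_support hf0) i
    rwa [ZMod.card] at this
  have hud : ∑ i, u i = f.totalDegree := by
    rw [← degree_degLexDegree, Finsupp.degree_eq_sum]
  let e : Fin m →₀ ℕ := Finsupp.equivFunOnFinite.symm fun i => p - 1 - u i
  have heu (i) : e i + u i = p - 1 := Nat.sub_add_cancel (hup i)
  have hed : ∑ i, e i + ∑ i, u i = m * (p - 1) := by
    rw [← Finset.sum_add_distrib, Finset.sum_congr rfl fun i _ => heu i]
    simp
  have h0 := hc (fun v => eval v (monomial e 1)) ⟨monomial e 1, by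
    refine (totalDegree_monomial_le _ _).trans ?_
    rw [Finsupp.sum_fintype _ _ fun _ => rfl]
    change ∑ i, e i ≤ r
    lia, fun _ => rfl⟩
  have h1 : ∑ t ∈ f.support, f.coeff t * ∏ i, ∑ a : ZMod p, a ^ (e i + t i) = 0 := by
    rw [← h0]
    simp only [← sum_prod_pow, Finset.mul_sum]
    rw [Finset.sum_comm]
    refine Finset.sum_congr rfl fun v _ => ?_
    have h2 : c v = eval v f := by rw [← hfc]; rfl
    rw [h2, eval_eq', Finset.mul_sum]
    refine Finset.sum_congr rfl fun t _ => ?_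
    beta_reduce
    rw [eval_monomial, Finsupp.prod_fintype _ _ fun _ => pow_zero _]
    simp only [pow_add, Finset.prod_mul_distrib]
    ring
  rw [Finset.sum_eq_single u] at h1
  · have h2 : f.coeff u ≠ 0 := coeff_degree_ne_zero_iff.2 hf0
    simp [heu, sum_pow_pred, h2] at h1
  · intro t ht htu
    -- An exponent `t ≠ u` of no larger total degree is below `u` in some coordinate, where the
    -- power sum has exponent below `p - 1` and vanishes.
    obtain ⟨i, hi⟩ : ∃ i, t i < u i := by
      by_contra! hle
      have h2 : ∑ i, t i ≤ ∑ i, u i := by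
        rw [hud, ← Finsupp.degree_eq_sum]
        exact le_totalDegree ht
      refine htu (Finsupp.ext fun i => ?_)
      exact ((Finset.sum_eq_sum_iff_of_le fun i _ => hle i).1
        (le_antisymm (Finset.sum_le_sum fun i _ => hle i) h2) i (Finset.mem_univ i)).symm
    have h3 := heu i
    rw [Finset.prod_eq_zero (Finset.mem_univ i) (FiniteField.sum_pow_lt_card_sub_one (ZMod p) _ (by
      rw [ZMod.card]
      lia)), mul_zero]
  · intro h2
    exact absurd (degLex.degree_mem_support hf0) h2

end ReedMuller

/-! ### Products of boxes, their coefficientwise order and their tails -/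

section Boxes

open Polynomial

/-- The polynomial `1 + x + ⋯ + x ^ L`. -/
def box (L : ℕ) : ℕ[X] := ∑ j ∈ Finset.range (L + 1), X ^ j

theorem box_zero : box 0 = 1 := by simp [box]

theorem box_succ (L : ℕ) : box (L + 1) = box L + X ^ (L + 1) := Finset.sum_range_succ _ _

theorem box_add (k a : ℕ) : box (a + 1 + k) = box k + X ^ (k + 1) * box a := by
  rw [box, show a + 1 + k + 1 = k + 1 + (a + 1) by ring, Finset.sum_range_add, box, box,
    Finset.mul_sum]
  simp only [pow_add]

/-- The coefficientwise order on polynomials over `ℕ`. -/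
def CoeffLE (P Q : ℕ[X]) : Prop := ∃ R, Q = P + R

theorem CoeffLE.refl (P : ℕ[X]) : CoeffLE P P := ⟨0, (add_zero P).symm⟩

theorem CoeffLE.trans {P Q R : ℕ[X]} (h : CoeffLE P Q) (h' : CoeffLE Q R) : CoeffLE P R := by
  obtain ⟨A, rfl⟩ := h
  obtain ⟨B, rfl⟩ := h'
  exact ⟨A + B, add_assoc _ _ _⟩

theorem CoeffLE.mul_left {P Q : ℕ[X]} (h : CoeffLE P Q) (R : ℕ[X]) :
    CoeffLE (R * P) (R * Q) := by
  obtain ⟨A, rfl⟩ := h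
  exact ⟨R * A, mul_add _ _ _⟩

theorem coeffLE_box_mul_step {d b : ℕ} (h : d + 1 ≤ b) :
    CoeffLE (box d * box (b + 1)) (box (d + 1) * box b) := by
  obtain ⟨k, rfl⟩ := Nat.exists_eq_add_of_le h
  -- With `b = d + 1 + k` the difference is `X ^ (d + 1) * (box b - X ^ (k + 1) * box d)`, and
  -- `box_add` evaluates the bracket.
  refine ⟨X ^ (d + 1) * box k, ?_⟩
  have h1 := box_add k d
  rw [box_succ d, box_succ (d + 1 + k), h1]
  ring

theorem coeffLE_box_mul_add (n : ℕ) :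
    ∀ {d b : ℕ}, d + n ≤ b → CoeffLE (box d * box (b + n)) (box (d + n) * box b) := by
  induction n with
  | zero => exact fun _ => CoeffLE.refl _
  | succ n ih =>
    intro d b h
    have h1 := ih (d := d + 1) (b := b) (by lia)
    rw [show d + 1 + n = d + (n + 1) by ring] at h1
    exact (coeffLE_box_mul_step (by lia)).trans h1

/-- At fixed total side, the more unequal pair of sides has the smaller product. -/
theorem coeffLE_box_mul {a b c d : ℕ} (h : a + b = c + d) (ha : d ≤ a) (hb : d ≤ b) :
    CoeffLE (box d * box c) (box a * box b) := by
  wlog hab : a ≤ b generalizing a b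
  · rw [mul_comm (box a)]
    exact this (by lia) hb ha (by lia)
  · have h1 := coeffLE_box_mul_add (a - d) (d := d) (b := b) (by lia)
    rwa [show b + (a - d) = c by lia, show d + (a - d) = a by lia] at h1

/-- The product of the boxes of side at most `q`, with total side length `N`, which is least
coefficientwise. -/
def packedBox (q N : ℕ) : ℕ[X] := box q ^ (N / q) * box (N % q)

variable {q : ℕ}

theorem packedBox_eq (hq : 0 < q) (a : ℕ) {b : ℕ} (hb : b ≤ q) :
    packedBox q (a * q + b) = box q ^ a * box b := by
  obtain rfl | hb := hb.eq_or_lt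
  · rw [packedBox, ← Nat.succ_mul, Nat.mul_div_cancel _ hq, Nat.mul_mod_left, box_zero, mul_one,
      pow_succ]
  · rw [packedBox, add_comm, Nat.add_mul_div_right _ _ hq, Nat.div_eq_of_lt hb, zero_add,
      Nat.add_mul_mod_self_right, Nat.mod_eq_of_lt hb]

theorem packedBox_of_le (hq : 0 < q) {b : ℕ} (hb : b ≤ q) : packedBox q b = box b := by
  simpa using packedBox_eq hq 0 hb

theorem packedBox_add_self (hq : 0 < q) (N : ℕ) :
    packedBox q (q + N) = box q * packedBox q N := by
  rw [packedBox, Nat.add_div_left _ hq, Nat.add_mod_left, pow_succ', packedBox, mul_assoc]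

theorem coeffLE_packedBox_of_le (hq : 0 < q) {M N : ℕ} (h : M ≤ N) :
    CoeffLE (packedBox q M) (packedBox q N) := by
  induction N, h using Nat.le_induction with
  | base => exact CoeffLE.refl _
  | succ N _ ih =>
    refine ih.trans ?_
    have hb := Nat.mod_lt N hq
    have hN := Nat.div_add_mod' N q
    have h1 := packedBox_eq hq (N / q) hb.le
    have h2 := packedBox_eq hq (N / q) (b := N % q + 1) hb
    rw [← add_assoc, hN] at h2
    rw [hN] at h1
    rw [h1, h2]
    exact CoeffLE.mul_left ⟨_, box_succ _⟩ _

theorem coeffLE_packedBox_add (hq : 0 < q) {L : ℕ} (hL : L ≤ q) (N : ℕ) :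
    CoeffLE (packedBox q (L + N)) (box L * packedBox q N) := by
  have hb := Nat.mod_lt N hq
  have hN := Nat.div_add_mod' N q
  set a := N / q
  set b := N % q
  rw [← hN, packedBox_eq hq a hb.le, mul_left_comm]
  by_cases h : L + b ≤ q
  · rw [show L + (a * q + b) = a * q + (L + b) by ring, packedBox_eq hq a h]
    have h1 := coeffLE_box_mul (a := L) (b := b) (c := L + b) (d := 0) rfl (by lia) (by lia)
    rw [box_zero, one_mul] at h1
    exact h1.mul_left _
  -- Overflow: the sides `L` and `b` become a full side `q` and the excess `L + b - q`.
  · rw [show L + (a * q + b) = (a + 1) * q + (L + b - q) by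
      rw [add_mul, one_mul]; lia, packedBox_eq hq (a + 1) (by lia), pow_succ, mul_assoc,
      mul_comm (box q)]
    exact (coeffLE_box_mul (by lia) (by lia) (by lia)).mul_left _

theorem coeffLE_packedBox_sum (hq : 0 < q) {ι : Type*} (s : Finset ι) {L : ι → ℕ}
    (hL : ∀ i, L i ≤ q) : CoeffLE (packedBox q (∑ i ∈ s, L i)) (∏ i ∈ s, box (L i)) := by
  classical
  induction s using Finset.induction_on with
  | empty => simpa [packedBox_of_le hq, box_zero] using CoeffLE.refl 1
  | insert i s hi ih =>
    rw [Finset.sum_insert hi, Finset.prod_insert hi]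
    exact (coeffLE_packedBox_add hq (hL i) _).trans (ih.mul_left _)

theorem exists_prod_box_eq_packedBox (hq : 0 < q) (m : ℕ) :
    ∀ {N : ℕ}, N ≤ m * q → ∃ L : Fin m → ℕ, (∀ i, L i ≤ q) ∧ ∑ i, L i = N ∧
      ∏ i, box (L i) = packedBox q N := by
  induction m with
  | zero =>
    intro N hN
    obtain rfl : N = 0 := by lia
    exact ⟨fun _ => 0, fun _ => Nat.zero_le _, by simp, by simp [packedBox_of_le hq, box_zero]⟩
  | succ m ih =>
    intro N hN
    by_cases h : N ≤ q
    · obtain ⟨L, hL, hLs, hLp⟩ := ih (Nat.zero_le _)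
      refine ⟨Fin.cons N L, fun i => ?_, ?_, ?_⟩
      · refine Fin.cases ?_ (fun i => ?_) i
        · exact h
        · exact hL i
      · simp [Fin.sum_univ_succ, hLs]
      · simp [Fin.prod_univ_succ, hLp, packedBox_of_le hq, box_zero, h]
    · obtain ⟨L, hL, hLs, hLp⟩ := ih (N := N - q) (by rw [add_mul] at hN; lia)
      refine ⟨Fin.cons q L, fun i => ?_, ?_, ?_⟩
      · refine Fin.cases ?_ (fun i => ?_) i
        · exact le_rfl
        · exact hL i
      · simp only [Fin.sum_univ_succ, Fin.cons_zero, Fin.cons_succ, hLs]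
        lia
      · simp only [Fin.prod_univ_succ, Fin.cons_zero, Fin.cons_succ, hLp]
        rw [← packedBox_add_self hq, Nat.add_sub_cancel' (by lia)]

/-- The sum of the coefficients of index larger than `w`. -/
def tailSum (w : ℤ) : ℕ[X] →ₗ[ℕ] ℕ :=
  Polynomial.lsum fun i => if w < (i : ℤ) then LinearMap.id else 0

theorem tailSum_monomial (w : ℤ) (i c : ℕ) :
    tailSum w (monomial i c) = if w < (i : ℤ) then c else 0 := by
  rw [tailSum, lsum_apply, sum_monomial_index]
  · split_ifs <;> rfl
  · exact map_zero _

theorem tailSum_X_pow (w : ℤ) (i : ℕ) : tailSum w (X ^ i) = if w < (i : ℤ) then 1 else 0 := by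
  rw [X_pow_eq_monomial, tailSum_monomial]

theorem tailSum_mul_X_pow (w : ℤ) (P : ℕ[X]) (j : ℕ) :
    tailSum w (P * X ^ j) = tailSum (w - j) P := by
  induction P using Polynomial.induction_on' with
  | add P Q hP hQ => rw [add_mul, map_add, hP, hQ, map_add]
  | monomial i c =>
    rw [monomial_mul_X_pow, tailSum_monomial, tailSum_monomial]
    push_cast
    simp only [sub_lt_iff_lt_add]

theorem CoeffLE.tailSum_le {P Q : ℕ[X]} (h : CoeffLE P Q) (w : ℤ) :
    tailSum w P ≤ tailSum w Q := by
  obtain ⟨R, rfl⟩ := h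
  rw [map_add]
  exact Nat.le_add_right _ _

variable {p : ℕ} [Fact p.Prime] {m : ℕ}

theorem box_pred : box (p - 1) = ∑ j ∈ Finset.range p, (X : ℕ[X]) ^ j := by
  rw [box, Nat.sub_add_cancel (Fact.out : p.Prime).one_le]

theorem natDegree_box_le (L : ℕ) : (box L).natDegree ≤ L :=
  natDegree_sum_le_of_forall_le _ _ fun j hj =>
    (natDegree_X_pow_le j).trans (Nat.lt_succ_iff.1 (Finset.mem_range.1 hj))

theorem pnomialGT_eq_tailSum (w : ℤ) : pnomialGT p m w = tailSum w (box (p - 1) ^ m) := by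
  have h : (box (p - 1) ^ m).natDegree < m * (p - 1) + 1 :=
    Nat.lt_succ_of_le (natDegree_pow_le_of_le m (natDegree_box_le _))
  rw [tailSum, lsum_apply, sum_over_range' _ (fun _ => map_zero _) _ h, pnomialGT,
    Finset.sum_filter]
  refine Finset.sum_congr rfl fun i _ => ?_
  rw [pnomial, ← box_pred]
  split_ifs <;> rfl

theorem sum_X_pow_manhattanWeight {L : Fin m → ℕ} (hL : ∀ i, L i ≤ p - 1) :
    ∑ y : Fin m → ZMod p with ∀ i, (y i).val ≤ L i, (X : ℕ[X]) ^ manhattanWeight y =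
      ∏ i, box (L i) := by
  have hp := (Fact.out : p.Prime).one_le
  have h (i) : box (L i) = ∑ x : ZMod p with x.val ≤ L i, (X : ℕ[X]) ^ x.val := by
    rw [Finset.sum_filter, sum_zmod_val fun j => if j ≤ L i then (X : ℕ[X]) ^ j else 0,
      ← Finset.sum_filter, box]
    refine Finset.sum_congr ?_ fun _ _ => rfl
    ext j
    have := hL i
    simp only [Finset.mem_range, Finset.mem_filter]
    lia
  simp only [h]
  rw [Finset.prod_univ_sum]
  refine Finset.sum_congr ?_ fun y _ => (Finset.prod_pow_eq_pow_sum _ _ _).symm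
  ext y
  simp

theorem card_box_manhattanWeight_gt {L : Fin m → ℕ} (hL : ∀ i, L i ≤ p - 1) (w : ℕ) :
    (Finset.univ.filter fun y : Fin m → ZMod p =>
      (∀ i, (y i).val ≤ L i) ∧ w < manhattanWeight y).card = tailSum w (∏ i, box (L i)) := by
  rw [← sum_X_pow_manhattanWeight hL, map_sum, ← Finset.filter_filter, Finset.card_filter]
  simp only [tailSum_X_pow, Nat.cast_lt]

theorem sum_X_pow_manhattanWeight_univ :
    ∑ y : Fin m → ZMod p, (X : ℕ[X]) ^ manhattanWeight y = box (p - 1) ^ m := by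
  have h := sum_X_pow_manhattanWeight (p := p) (L := fun _ : Fin m => p - 1) fun _ => le_rfl
  rw [Finset.prod_const, Finset.card_univ, Fintype.card_fin] at h
  rw [← h, Finset.filter_true_of_mem fun y _ i => Nat.le_sub_one_of_lt (y i).val_lt]

theorem card_manhattanBall (w : ℕ) : (manhattanBall p m w).card = pnomialLE p m w := by
  simp only [pnomialLE, pnomial, ← box_pred, ← sum_X_pow_manhattanWeight_univ, finsetSum_coeff,
    coeff_X_pow]
  rw [Finset.sum_comm, manhattanBall, Finset.card_filter]
  refine Finset.sum_congr rfl fun y _ => ?_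
  simp

theorem card_compl_manhattanBall (w : ℕ) :
    Fintype.card {v : Fin m → ZMod p // v ∉ manhattanBall p m w} = pnomialGT p m w := by
  rw [pnomialGT_eq_tailSum, ← sum_X_pow_manhattanWeight_univ, map_sum, Fintype.card_subtype,
    Finset.card_filter]
  simp [manhattanBall, tailSum_X_pow]

/-- The packed box has `m - α - 1` full sides and one of length `p - 1 - β`; each term `X ^ j` of
the latter lowers the threshold by `j`. For `β = 0` that side is full too, which `packedBox_eq`
allows. -/
theorem Delta_eq_tailSum {t : ℕ} (ht : t < m * (p - 1)) (w : ℕ) :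
    Delta p m t w = tailSum w (packedBox (p - 1) (m * (p - 1) - t)) := by
  have hp := (Fact.out : p.Prime).two_le
  have hq : 0 < p - 1 := by lia
  have hα : t / (p - 1) < m := (Nat.div_lt_iff_lt_mul hq).2 ht
  have hβ := Nat.mod_lt t hq
  have hαβ := Nat.div_add_mod' t (p - 1)
  rw [Delta, if_pos hα]
  set α := t / (p - 1)
  set β := t % (p - 1)
  obtain ⟨k, rfl⟩ := Nat.exists_eq_add_of_lt hα
  have h : (α + k + 1) * (p - 1) - t = k * (p - 1) + (p - 1 - β) := by
    rw [add_mul, add_mul, one_mul]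
    lia
  rw [h, packedBox_eq hq k (Nat.sub_le _ _), box.eq_def (p - 1 - β), Finset.mul_sum, map_sum,
    show α + k + 1 - α - 1 = k by lia, show p - 1 - β + 1 = p - β by lia]
  exact Finset.sum_congr rfl fun j _ => by rw [pnomialGT_eq_tailSum, tailSum_mul_X_pow]

end Boxes

/-! ### Minimum weight outside the Manhattan ball -/

section MinimumDistance

open MvPolynomial

variable {p : ℕ} [Fact p.Prime] {m : ℕ}

theorem mem_manhattanBall {w : ℕ} {v : Fin m → ZMod p} :
    v ∈ manhattanBall p m w ↔ manhattanWeight v ≤ w :=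
  Finset.mem_filter.trans (and_iff_right (Finset.mem_univ _))

theorem card_filter_compl_manhattanBall (w : ℕ) (P : (Fin m → ZMod p) → Prop) [DecidablePred P] :
    (Finset.univ.filter fun v : {v // v ∉ manhattanBall p m w} => P v).card =
      (Finset.univ.filter fun x : Fin m → ZMod p => P x ∧ w < manhattanWeight x).card := by
  rw [← Finset.card_map (Function.Embedding.subtype _)]
  congr 1
  ext x
  rw [Finset.mem_map, Finset.mem_filter]
  constructor
  · rintro ⟨v, hv, rfl⟩
    exact ⟨Finset.mem_univ _, (Finset.mem_filter.1 hv).2, not_le.1 (mt mem_manhattanBall.2 v.2)⟩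
  · rintro ⟨-, hP, hx⟩
    exact ⟨⟨x, mt mem_manhattanBall.1 hx.not_ge⟩, Finset.mem_filter.2 ⟨Finset.mem_univ _, hP⟩, rfl⟩

theorem Delta_le_card_ne_zero {t w : ℕ} (ht : t < m * (p - 1)) {y : (Fin m → ZMod p) → ZMod p}
    (hy : y ∈ reedMuller p t m) (hy0 : y ≠ 0) :
    Delta p m t w ≤
      (Finset.univ.filter fun v : {v // v ∉ manhattanBall p m w} => y v ≠ 0).card := by
  have hp := (Fact.out : p.Prime).two_le
  obtain ⟨f, hft, hfp, hyf⟩ := exists_reduced_of_mem_reedMuller hy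
  have hf0 : f ≠ 0 := by
    rintro rfl
    exact hy0 (funext fun v => by simp [hyf])
  set u := MonomialOrder.degLex.degree f with hu
  have hup (i) : u i ≤ p - 1 := hfp u (MonomialOrder.degLex.degree_mem_support hf0) i
  have hud : ∑ i, u i ≤ t := by
    rw [← Finsupp.degree_eq_sum, hu, degree_degLexDegree]
    exact hft
  have hsum : m * (p - 1) - t ≤ ∑ i, (p - 1 - u i) := by
    have h1 : ∑ i, (p - 1 - u i) + ∑ i, u i = m * (p - 1) := by
      rw [← Finset.sum_add_distrib, Finset.sum_congr rfl fun i _ => Nat.sub_add_cancel (hup i)]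
      simp
    lia
  rw [Delta_eq_tailSum ht, card_filter_compl_manhattanBall w fun v => y v ≠ 0]
  refine (((coeffLE_packedBox_of_le (by lia) hsum).trans
    (coeffLE_packedBox_sum (by lia) _ fun i => Nat.sub_le _ _)).tailSum_le w).trans ?_
  rw [← card_box_manhattanWeight_gt fun i => Nat.sub_le _ _]
  simp only [hyf]
  refine le_trans (Finset.card_le_card fun x hx => ?_) (card_le_card_eval_ne_zero hf0 w)
  simp only [Finset.mem_filter, Finset.mem_univ, true_and] at hx ⊢
  refine ⟨fun i => ?_, hx.2⟩
  have h1 := hx.1 i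
  have h2 := hup i
  lia

theorem exists_mem_reedMuller_card_eq_Delta {t : ℕ} (ht : t < m * (p - 1)) (w : ℕ) :
    ∃ y ∈ reedMuller p t m, y 0 ≠ 0 ∧
      (Finset.univ.filter fun v : {v // v ∉ manhattanBall p m w} => y v ≠ 0).card =
        Delta p m t w := by
  have hp := (Fact.out : p.Prime).two_le
  obtain ⟨L, hL, hLs, hLp⟩ :=
    exists_prod_box_eq_packedBox (q := p - 1) (by lia) m (Nat.sub_le (m * (p - 1)) t)
  -- Its nonzeros are exactly the points of a box with packed side lengths; the origin is among them
  -- and lies in every Manhattan ball.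
  let f : MvPolynomial (Fin m) (ZMod p) := ∏ i, ∏ c : ZMod p with L i < c.val, (X i - C c)
  have hf (x : Fin m → ZMod p) : eval x f ≠ 0 ↔ ∀ i, (x i).val ≤ L i := by
    simp only [f, map_prod, map_sub, eval_X, eval_C, Finset.prod_ne_zero_iff, Finset.mem_univ,
      Finset.mem_filter, true_and, forall_true_left, sub_ne_zero]
    refine forall_congr' fun i => ⟨fun h => ?_, fun h c hc hxc => ?_⟩
    · by_contra! hi
      exact h _ hi rfl
    · rw [← hxc] at hc
      lia
  have hdeg : f.totalDegree ≤ t := by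
    have h1 (i) : (Finset.univ.filter fun c : ZMod p => L i < c.val).card = p - 1 - L i := by
      rw [Finset.card_filter, sum_zmod_val fun j => if L i < j then 1 else 0, ← Finset.card_filter]
      have h2 : (Finset.range p).filter (fun j => L i < j) = Finset.Ioo (L i) p := by
        ext j
        simp [and_comm]
      rw [h2, Nat.card_Ioo]
      lia
    have h2 : f.totalDegree ≤ ∑ i, (p - 1 - L i) := by
      refine (totalDegree_finsetProd _ _).trans (Finset.sum_le_sum fun i _ => ?_)
      refine (totalDegree_finsetProd _ _).trans ?_
      rw [← h1, Finset.card_eq_sum_ones]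
      exact Finset.sum_le_sum fun c _ => (totalDegree_sub_C_le _ _).trans (totalDegree_X _).le
    have h3 : ∑ i, (p - 1 - L i) + ∑ i, L i = m * (p - 1) := by
      rw [← Finset.sum_add_distrib, Finset.sum_congr rfl fun i _ => Nat.sub_add_cancel (hL i)]
      simp
    lia
  refine ⟨fun v => eval v f, ⟨f, hdeg, fun _ => rfl⟩, (hf 0).2 fun i => by simp, ?_⟩
  rw [Delta_eq_tailSum ht, ← hLp, ← card_box_manhattanWeight_gt hL,
    card_filter_compl_manhattanBall w fun v => eval v f ≠ 0]
  simp only [hf]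

end MinimumDistance

end QuantumReedMuller

end

/-! ### The parameters of the punctured code -/

theorem mainTheorem1 (p : ℕ) [Fact p.Prime] (m r w : ℕ)
    (hr : 3 * r < m * (p - 1)) (hw : w < m * (p - 1) - r)
    (hΔ : 0 < QuantumReedMuller.Delta p m (m * (p - 1) - r - 1) w) :
    QuantumReedMuller.IsTriorthogonalSpace (QuantumReedMuller.reedMuller p r m) ∧
      QuantumReedMuller.HasParameters
        (QuantumReedMuller.triorthogonalCode (QuantumReedMuller.reedMuller p r m)
          (QuantumReedMuller.manhattanBall p m w))
        (QuantumReedMuller.pnomialGT p m (w : ℤ))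
        (QuantumReedMuller.pnomialLE p m w)
        (QuantumReedMuller.Delta p m (m * (p - 1) - r - 1) w) := by
  obtain ⟨y, hy, hy0, hyd⟩ := QuantumReedMuller.exists_mem_reedMuller_card_eq_Delta
    (p := p) (m := m) (t := m * (p - 1) - r - 1) (by lia) w
  have hdual : QuantumReedMuller.dualCode (QuantumReedMuller.reedMuller p r m) =
      QuantumReedMuller.reedMuller p (m * (p - 1) - r - 1) m :=
    QuantumReedMuller.dualCode_reedMuller (by lia)
  refine ⟨QuantumReedMuller.isTriorthogonalSpace_reedMuller hr, ?_⟩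
  rw [← QuantumReedMuller.card_compl_manhattanBall, ← QuantumReedMuller.card_manhattanBall]
  refine QuantumReedMuller.hasParameters_triorthogonalCode ?_ hΔ
    (fun z hz hz0 => ?_) (y := y) ?_ ⟨0, ?_, hy0⟩ hyd
  · rw [hdual]
    -- From `3 * r < m * (p - 1)` one gets `r ≤ m * (p - 1) - r - 1`, so the code lies in its dual.
    exact QuantumReedMuller.reedMuller_mono (by lia)
  · rw [hdual] at hz
    exact QuantumReedMuller.Delta_le_card_ne_zero (by lia) hz hz0
  · rwa [hdual]
  · exact QuantumReedMuller.mem_manhattanBall.2 (by simp [QuantumReedMuller.manhattanWeight])
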